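/- Let $H$ be a real finite-dimensional Hilbert space, let $P:H\to H$ be an orthogonal projection, and let $\Lambda:H\to\mathbb{R}^m$ be a linear map with $\Lambda\Lambda^*=\mathrm{Id}_{m}$ and $\ker(P)\cap\ker(\Lambda)=\{0\}$; exclude the degenerate case where simultaneously $\dim H=1$, $P=\mathrm{Id}_H$ and $m=1$. Let $\varepsilon,\eta>0$, put $$\mathcal{K}=\{f\in H:\|Pf\|\le\varepsilon\},\qquad \mathcal{E}=\{e\in\mathbb{R}^m:\|e\|_2\le\eta\},$$ and let $y\in\mathbb{R}^m$ be such that $\mathcal{K}_{y,\mathcal{E}}=\{f\in H: f\in\mathcal{K}\text{ and }y-\Lambda f\in\mathcal{E}\}$ is nonempty. The Chebyshev radius of a set $S \subseteq H$ is the infimum of the radii of the closed balls containing $S$, and a Chebyshev center of $S$ is the center of a closed ball of that radius containing $S$. Then the set $\mathcal{K}_{y,\mathcal{E}}$ has a finite Chebyshev radius, and the square of this radius is equal to the optimal value of the semidefinite program $$\underset{c,d\ge 0,\;t\in\mathbb{R}}{\text{minimize}}\quad c\varepsilon^2+d\eta^2-d\|y\|_2^2+t\quad\text{subject to}\quad cP+d\Lambda^*\Lambda\succeq\mathrm{Id}_H\quad\text{and}\quad\begin{bmatrix}cP+d\Lambda^*\Lambda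 & d\Lambda^*y\\ d\,y^*\Lambda & t\end{bmatrix}\succeq 0,$$ which is attained. Moreover, for every solution $(\widetilde c,\widetilde d,\widetilde t)$ of this program, the function $f\mapsto\widetilde c\,\|Pf\|^2+\widetilde d\,\|y-\Lambda f\|_2^2$ has a unique minimizer $f_{\widetilde c,\widetilde d}$ over $H$, and $f_{\widetilde c,\widetilde d}$ is the unique Chebyshev center of $\mathcal{K}_{y,\mathcal{E}}$. -/

import Mathlib

namespace ChebyshevSDP

noncomputable section

/-- The radii of the closed balls that contain `S`. -/
def coveringRadii {H : Type*} [NormedAddCommGroup H] (S : Set H) : Set ℝ :=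
  {r | 0 ≤ r ∧ ∃ z : H, S ⊆ Metric.closedBall z r}

/-- `r` is the Chebyshev radius of `S`: the infimum of the radii of the balls containing `S`,
that is, `inf_z sup_{f ∈ S} ‖f - z‖`. Stating it as a greatest lower bound includes that some ball
contains `S`. -/
def IsChebyshevRadius {H : Type*} [NormedAddCommGroup H] (S : Set H) (r : ℝ) : Prop :=
  IsGLB (coveringRadii S) r

/-- `z` is a Chebyshev center of `S`: the center of a smallest-radius ball containing `S`. -/
def IsChebyshevCenter {H : Type*} [NormedAddCommGroup H] (S : Set H) (z : H) : Prop :=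
  ∃ r : ℝ, IsChebyshevRadius S r ∧ S ⊆ Metric.closedBall z r

variable {H : Type*} [NormedAddCommGroup H] [InnerProductSpace ℝ H]

/-- The model set `{f : ‖P f‖ ≤ ε}`. -/
def modelSet (P : H →ₗ[ℝ] H) (ε : ℝ) : Set H := {f | ‖P f‖ ≤ ε}

/-- The uncertainty set `{e : ‖e‖₂ ≤ η}`. -/
def uncertaintySet (m : ℕ) (η : ℝ) : Set (EuclideanSpace ℝ (Fin m)) := {e | ‖e‖ ≤ η}

/-- The elements of `K` that are consistent with the data `y` up to an error in `E`. -/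
def consistentSet {m : ℕ} (Λ : H →ₗ[ℝ] EuclideanSpace ℝ (Fin m)) (K : Set H)
    (E : Set (EuclideanSpace ℝ (Fin m))) (y : EuclideanSpace ℝ (Fin m)) : Set H :=
  {f | f ∈ K ∧ y - Λ f ∈ E}

/-- The operator `[T, v; φ, t]` on the Hilbert sum of `H` and `ℝ`, which maps `(h, s)` to
`(T h + s v, φ h + t s)`. -/
def blockOperator (T : H →ₗ[ℝ] H) (v : H) (φ : H →ₗ[ℝ] ℝ) (t : ℝ) :
    WithLp 2 (H × ℝ) →ₗ[ℝ] WithLp 2 (H × ℝ) where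
  toFun x := WithLp.toLp 2 (T x.fst + x.snd • v, φ x.fst + t * x.snd)
  map_add' x y := by
    apply (WithLp.equiv 2 (H × ℝ)).injective
    refine Prod.ext ?_ ?_
    · simp [add_smul]; abel
    · simp; ring
  map_smul' a x := by
    apply (WithLp.equiv 2 (H × ℝ)).injective
    refine Prod.ext ?_ ?_
    · simp [mul_smul]
    · simp; ring

variable [FiniteDimensional ℝ H] {m : ℕ}

/-- The operator `c P + d Λ* Λ`. -/
def combination (P : H →ₗ[ℝ] H) (Λ : H →ₗ[ℝ] EuclideanSpace ℝ (Fin m)) (c d : ℝ) : H →ₗ[ℝ] H :=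
  c • P + d • (Λ.adjoint ∘ₗ Λ)

/-- The feasible triples `(c, d, t)` of the semidefinite program. -/
def sdpFeasible (P : H →ₗ[ℝ] H) (Λ : H →ₗ[ℝ] EuclideanSpace ℝ (Fin m))
    (y : EuclideanSpace ℝ (Fin m)) : Set (ℝ × ℝ × ℝ) :=
  {(c, d, t) | 0 ≤ c ∧ 0 ≤ d ∧
    (combination P Λ c d - LinearMap.id).IsPositive ∧
    (blockOperator (combination P Λ c d) (d • Λ.adjoint y)
      (d • (innerₗ (EuclideanSpace ℝ (Fin m)) y ∘ₗ Λ)) t).IsPositive}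

/-- The objective function of the semidefinite program. -/
def sdpObjective (ε η : ℝ) (y : EuclideanSpace ℝ (Fin m)) : ℝ × ℝ × ℝ → ℝ :=
  fun (c, d, t) => c * ε ^ 2 + d * η ^ 2 - d * ‖y‖ ^ 2 + t

/-- `(c, d, t)` solves the semidefinite program: it is feasible and minimizes the objective. -/
def IsSDPSolution (P : H →ₗ[ℝ] H) (Λ : H →ₗ[ℝ] EuclideanSpace ℝ (Fin m)) (ε η : ℝ)
    (y : EuclideanSpace ℝ (Fin m)) (x : ℝ × ℝ × ℝ) : Prop :=
  x ∈ sdpFeasible P Λ y ∧ IsMinOn (sdpObjective ε η y) (sdpFeasible P Λ y) x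

/-- The set of minimizers over `H` of `c ‖P f‖² + d ‖y - Λ f‖²`. -/
def regularizers (P : H →ₗ[ℝ] H) (Λ : H →ₗ[ℝ] EuclideanSpace ℝ (Fin m))
    (y : EuclideanSpace ℝ (Fin m)) (c d : ℝ) : Set H :=
  {f | IsMinOn (fun g : H => c * ‖P g‖ ^ 2 + d * ‖y - Λ g‖ ^ 2) Set.univ f}

end

end ChebyshevSDP

open ChebyshevSDP

/-! Upper bound: if `A = c P + d Λ* Λ` dominates the identity and `A f = d Λ* y`, completing the
square at `f` turns the two constraints on `x` into a bound of `‖x - f‖²` by the objective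
(`norm_sub_sq_le_objective`), so every feasible triple yields a covering ball. Lower bound:
`exists_certificate` supplies a feasible triple and a segment `[f - v, f + v]` with consistent
endpoints and `‖v‖²` equal to the objective. A ball containing both endpoints has radius at least
`‖v‖`, with equality only for center `f` (`norm_sub_sq_add_le`). This gives the radius, the optimal
value and uniqueness of the center together.

To find the segment, write `y = Λ u + Λ q` with `P u = 0` and `q` fixed by both projections
(`exists_data_splitting`), and work on the orthogonal complement `N` of `q`. Put `c = (1 - τ) / l`
and `d = τ / l`, with `l` the minimum of `(1 - τ)‖P x‖² + τ‖Λ x‖²` on the unit sphere of `N`; the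
objective becomes a ratio `g τ / l τ`, minimized over `[0, 1]`. At an interior minimizer, the
one-sided first-order conditions give null vectors of the slack form on which the derivative form
has opposite signs. Null vectors of a semidefinite form make up a subspace, so the intermediate
value theorem yields a common zero (`exists_null_of_signs`). Scaled by the square root of the
minimal ratio, it is `v` (`exists_multipliers`). -/

open Filter Topology

/-! ### Compactness and first-order conditions -/

/-- First-order information at a maximum of a family `t ↦ F + t D + k t²` of functions on a
compact set. -/
theorem exists_first_order {X : Type*} [PseudoMetricSpace X] {S : Set X} (hS : IsCompact S)
    {F D : X → ℝ} (hF : Continuous F) (hD : Continuous D) (k t₀ : ℝ) (ht₀ : 0 < t₀)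
    (hF0 : ∀ x ∈ S, F x ≤ 0)
    (h : ∀ t, 0 < t → t ≤ t₀ → ∃ x ∈ S, 0 ≤ F x + t * D x + k * t ^ 2) :
    ∃ x ∈ S, F x = 0 ∧ 0 ≤ D x := by
  have hpos : ∀ n : ℕ, 0 < t₀ / ((n : ℝ) + 1) := fun n => by positivity
  have hle : ∀ n : ℕ, t₀ / ((n : ℝ) + 1) ≤ t₀ := fun n => by
    apply div_le_self ht₀.le
    have : (0 : ℝ) ≤ n := n.cast_nonneg
    linarith
  choose x hxS hx using fun n : ℕ => h _ (hpos n) (hle n)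
  have hlim : Tendsto (fun n : ℕ => t₀ / ((n : ℝ) + 1)) atTop (𝓝 0) := by
    have := (tendsto_one_div_add_atTop_nhds_zero_nat (𝕜 := ℝ)).const_mul t₀
    simpa [div_eq_mul_inv] using this
  obtain ⟨a, haS, φ, hφ, ha⟩ := hS.tendsto_subseq hxS
  have ht := hlim.comp hφ.tendsto_atTop
  have hFa := (hF.tendsto a).comp ha
  have hDa := (hD.tendsto a).comp ha
  refine ⟨a, haS, le_antisymm (hF0 a haS) ?_, ?_⟩
  · have h1 := (hFa.add (ht.mul hDa)).add ((ht.pow 2).const_mul k)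
    have h2 := ge_of_tendsto' h1 (fun n => hx (φ n))
    simpa using h2
  -- As `F ≤ 0` on `S`, the hypothesis leaves `t * (D + k t) ≥ 0`; divide by `t` before passing to
  -- the limit.
  · have h1 := hDa.add (ht.const_mul k)
    have h2 : ∀ n, 0 ≤ ((D ∘ x ∘ φ) n + k * ((fun n : ℕ => t₀ / ((n : ℝ) + 1)) ∘ φ) n) := by
      intro n
      have e1 := hx (φ n)
      have e2 := hF0 _ (hxS (φ n))
      have e3 := hpos (φ n)
      simp only [Function.comp_apply] at *
      by_contra hc
      push Not at hc
      nlinarith [mul_neg_of_pos_of_neg e3 hc]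
    have h3 := ge_of_tendsto' h1 h2
    simpa using h3

/-- A continuous quadratic form that takes both signs on the null cone of a semidefinite quadratic
form has a zero there. -/
theorem exists_null_of_signs {H : Type*} [NormedAddCommGroup H] [NormedSpace ℝ H]
    (N : Submodule ℝ H) {F D : H → ℝ} (hD : Continuous D)
    (hFpar : ∀ x y, F (x + y) + F (x - y) = 2 * F x + 2 * F y)
    (hFhom : ∀ (s : ℝ) x, F (s • x) = s ^ 2 * F x)
    (hDhom : ∀ (s : ℝ) x, D (s • x) = s ^ 2 * D x)
    (hF0 : ∀ x ∈ N, F x ≤ 0) {x y : H} (hxN : x ∈ N) (hyN : y ∈ N)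
    (hx1 : ‖x‖ = 1) (hy1 : ‖y‖ = 1)
    (hx : F x = 0) (hy : F y = 0) (hDx : 0 ≤ D x) (hDy : D y ≤ 0) :
    ∃ z ∈ N, ‖z‖ = 1 ∧ F z = 0 ∧ D z = 0 := by
  have hc : ContinuousOn (fun s : ℝ => D ((1 - s) • x + s • y)) (Set.Icc 0 1) := by fun_prop
  obtain ⟨s, hs, hs0⟩ := intermediate_value_Icc' zero_le_one hc
    (show (0 : ℝ) ∈ _ from ⟨by simpa using hDy, by simpa using hDx⟩)
  simp only at hs0
  set p := (1 - s) • x + s • y with hp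
  have hpN : p ∈ N := N.add_mem (N.smul_mem _ hxN) (N.smul_mem _ hyN)
  -- The values of `F` at the sum and the difference are both nonpositive and add up to zero.
  have hFp : F p = 0 := by
    have h1 := hFpar ((1 - s) • x) (s • y)
    rw [hFhom, hFhom, hx, hy] at h1
    have h2 := hF0 _ hpN
    have h3 := hF0 _ (N.sub_mem (N.smul_mem (1 - s) hxN) (N.smul_mem s hyN))
    linarith
  -- The segment meets the origin only if `y = -x`; then `D x = D y`, and the sign conditions make
  -- both zero.
  by_cases hp0 : p = 0
  · have h1 : (1 - s) • x = (-s) • y := by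
      rw [neg_smul]; exact eq_neg_of_add_eq_zero_left (hp ▸ hp0)
    have h2 : D x = D y := by
      have h3 : 1 - s = s := by
        have := congrArg norm h1
        simpa [norm_smul, hx1, hy1, abs_of_nonneg hs.1, abs_of_nonneg (sub_nonneg.2 hs.2)] using this
      have h4 : s = 1 / 2 := by linarith
      have h5 := congrArg D h1
      rw [hDhom, hDhom, h4] at h5
      linarith
    exact ⟨x, hxN, hx1, hx, by linarith⟩
  · refine ⟨‖p‖⁻¹ • p, N.smul_mem _ hpN, ?_, ?_, ?_⟩
    · rw [norm_smul, norm_inv, norm_norm, inv_mul_cancel₀ (norm_ne_zero_iff.2 hp0)]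
    · rw [hFhom, hFp, mul_zero]
    · rw [hDhom, hs0, mul_zero]

/-- The minimum over a compact set of an affine family of functions is continuous and attained. -/
theorem exists_continuous_min {X : Type*} [TopologicalSpace X] {S : Set X} (hS : IsCompact S)
    (hne : S.Nonempty) {G : ℝ → X → ℝ} (hG : Continuous ↿G) :
    ∃ l : ℝ → ℝ, Continuous l ∧ (∀ t, ∃ x ∈ S, G t x = l t) ∧ ∀ t, ∀ x ∈ S, l t ≤ G t x := by
  refine ⟨fun t => sInf (G t '' S), hS.continuous_sInf hG, fun t => ?_, fun t x hx => ?_⟩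
  · exact (hS.image (hG.comp (Continuous.prodMk_right t))).sInf_mem (hne.image _)
  · exact csInf_le (hS.image (hG.comp (Continuous.prodMk_right t))).bddBelow ⟨x, hx, rfl⟩

/-- A quotient `g / l` whose numerator and denominator do not vanish together attains its
minimum on a compact interval. -/
theorem exists_min_ratio {g l : ℝ → ℝ} (hg : Continuous g) (hl : Continuous l)
    (hg0 : ∀ t ∈ Set.Icc (0 : ℝ) 1, 0 ≤ g t) (hl0 : ∀ t ∈ Set.Icc (0 : ℝ) 1, 0 ≤ l t)
    (hgl : ∀ t ∈ Set.Icc (0 : ℝ) 1, l t = 0 → 0 < g t) {s : ℝ} (hs : s ∈ Set.Icc (0 : ℝ) 1)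
    (hls : 0 < l s) :
    ∃ t ∈ Set.Icc (0 : ℝ) 1, 0 < l t ∧ ∃ R, 0 ≤ R ∧ g t = R * l t ∧
      ∀ r ∈ Set.Icc (0 : ℝ) 1, R * l r ≤ g r := by
  -- A sublevel set of the ratio with the denominator cleared: it is closed even where `l` vanishes,
  -- and contains no zero of `l`.
  set S := Set.Icc (0 : ℝ) 1 ∩ {t | g t ≤ g s / l s * l t} with hSdef
  have hSc : IsCompact S := isCompact_Icc.inter_right (isClosed_le hg (by fun_prop))
  have hsS : s ∈ S := ⟨hs, by simp [div_mul_cancel₀ _ hls.ne']⟩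
  have hpos : ∀ t ∈ S, 0 < l t := by
    intro t ht
    rcases (hl0 t ht.1).eq_or_lt with h | h
    · have h1 := hgl t ht.1 h.symm
      have h2 : g t ≤ g s / l s * l t := ht.2
      rw [← h, mul_zero] at h2
      linarith
    · exact h
  obtain ⟨t, ht, hmin⟩ := hSc.exists_isMinOn ⟨s, hsS⟩
    (f := fun t => g t / l t) (hg.continuousOn.div hl.continuousOn fun t ht => (hpos t ht).ne')
  refine ⟨t, ht.1, hpos t ht, g t / l t, div_nonneg (hg0 t ht.1) (hl0 t ht.1),
    (div_mul_cancel₀ _ (hpos t ht).ne').symm, fun r hr => ?_⟩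
  by_cases hrS : r ∈ S
  · exact (le_div_iff₀ (hpos r hrS)).1 (hmin hrS)
  · have h1 : g s / l s * l r < g r := by
      by_contra hc
      exact hrS ⟨hr, not_lt.1 hc⟩
    exact (mul_le_mul_of_nonneg_right (hmin hsS) (hl0 r hr)).trans h1.le

/-! ### Multipliers and complementary slackness -/

theorem norm_map_sq_parallelogram {H E : Type*} [AddCommGroup H] [Module ℝ H]
    [NormedAddCommGroup E] [InnerProductSpace ℝ E] (T : H →ₗ[ℝ] E) (x y : H) :
    ‖T (x + y)‖ ^ 2 + ‖T (x - y)‖ ^ 2 = 2 * ‖T x‖ ^ 2 + 2 * ‖T y‖ ^ 2 := by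
  have := parallelogram_law_with_norm ℝ (T x) (T y)
  rw [map_add, map_sub]
  linarith

theorem norm_map_smul_sq {H E : Type*} [AddCommGroup H] [Module ℝ H]
    [NormedAddCommGroup E] [InnerProductSpace ℝ E] (T : H →ₗ[ℝ] E) (s : ℝ) (x : H) :
    ‖T (s • x)‖ ^ 2 = s ^ 2 * ‖T x‖ ^ 2 := by
  rw [map_smul, norm_smul, mul_pow, Real.norm_eq_abs, sq_abs]

/-- Existence of multipliers `(1 - τ) / l`, `τ / l` with a vector `v` that satisfies
complementary slackness. -/
theorem exists_multipliers {H E₁ E₂ : Type*} [NormedAddCommGroup H] [InnerProductSpace ℝ H]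
    [FiniteDimensional ℝ H] [NormedAddCommGroup E₁] [InnerProductSpace ℝ E₁]
    [NormedAddCommGroup E₂] [InnerProductSpace ℝ E₂] (P : H →ₗ[ℝ] E₁) (T : H →ₗ[ℝ] E₂)
    (N : Submodule ℝ H) (hN : N ≠ ⊥) (hP : ∀ x, ‖P x‖ ≤ ‖x‖) (hT : ∀ x, ‖T x‖ ≤ ‖x‖)
    (hker : ∀ x ∈ N, P x = 0 → T x = 0 → x = 0) {ε η L : ℝ} (hε : 0 < ε) (hη : 0 < η)
    (hg : ∀ s ∈ Set.Icc (0 : ℝ) 1, 0 ≤ (1 - s) * ε ^ 2 + s * η ^ 2 - s * (1 - s) * L ^ 2) :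
    ∃ τ ∈ Set.Icc (0 : ℝ) 1, ∃ l, 0 < l ∧ l ≤ 1 ∧
      (∀ x ∈ N, l * ‖x‖ ^ 2 ≤ (1 - τ) * ‖P x‖ ^ 2 + τ * ‖T x‖ ^ 2) ∧
      ∃ v ∈ N, l * ‖v‖ ^ 2 = (1 - τ) * ε ^ 2 + τ * η ^ 2 - τ * (1 - τ) * L ^ 2 ∧
        ‖P v‖ ^ 2 ≤ ε ^ 2 - τ ^ 2 * L ^ 2 ∧ ‖T v‖ ^ 2 ≤ η ^ 2 - (1 - τ) ^ 2 * L ^ 2 := by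
  have hPc : Continuous P := P.continuous_of_finiteDimensional
  have hTc : Continuous T := T.continuous_of_finiteDimensional
  set S : Set H := Metric.sphere 0 1 ∩ N with hSdef
  have hSc : IsCompact S := (isCompact_sphere 0 1).inter_right N.closed_of_finiteDimensional
  have hSnorm : ∀ x ∈ S, ‖x‖ = 1 := fun x hx => by simpa using hx.1
  have hSne : S.Nonempty := by
    obtain ⟨x, hxN, hx0⟩ := N.ne_bot_iff.1 hN
    refine ⟨‖x‖⁻¹ • x, ?_, N.smul_mem _ hxN⟩
    simp [norm_smul, inv_mul_cancel₀ (norm_ne_zero_iff.2 hx0)]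
  set G : ℝ → H → ℝ := fun s x => (1 - s) * ‖P x‖ ^ 2 + s * ‖T x‖ ^ 2 with hGdef
  have hGc : Continuous ↿G := by
    simp only [hGdef, Function.HasUncurry.uncurry, id]
    fun_prop
  obtain ⟨l, hlc, hlmem, hlle⟩ := exists_continuous_min hSc hSne hGc
  set g : ℝ → ℝ := fun s => (1 - s) * ε ^ 2 + s * η ^ 2 - s * (1 - s) * L ^ 2 with hgdef
  have hGnn : ∀ s ∈ Set.Icc (0 : ℝ) 1, ∀ x, 0 ≤ G s x := fun s hs x => by
    have := hs.1
    have := sub_nonneg.2 hs.2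
    simp only [hGdef]
    positivity
  have hinterior : ∀ s, 0 < s → s < 1 → 0 < l s := by
    intro s h0 h1
    obtain ⟨x, hx, hxl⟩ := hlmem s
    rw [← hxl]
    refine (hGnn s ⟨h0.le, h1.le⟩ x).lt_of_ne fun h => ?_
    have e1 : 0 ≤ (1 - s) * ‖P x‖ ^ 2 := mul_nonneg (by linarith) (sq_nonneg _)
    have e2 : 0 ≤ s * ‖T x‖ ^ 2 := mul_nonneg h0.le (sq_nonneg _)
    simp only [hGdef] at h
    have e3 : (1 - s) * ‖P x‖ ^ 2 = 0 := by linarith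
    have e4 : s * ‖T x‖ ^ 2 = 0 := by linarith
    have e5 : P x = 0 := by
      simpa [(sub_pos.2 h1).ne'] using e3
    have e6 : T x = 0 := by
      simpa [h0.ne'] using e4
    have := hker x hx.2 e5 e6
    have h7 := hSnorm x hx
    simp [this] at h7
  have hl0 : ∀ s ∈ Set.Icc (0 : ℝ) 1, 0 ≤ l s := fun s hs => by
    obtain ⟨x, -, hxl⟩ := hlmem s
    exact hxl ▸ hGnn s hs x
  have hgl : ∀ s ∈ Set.Icc (0 : ℝ) 1, l s = 0 → 0 < g s := by
    intro s hs h
    -- Only the endpoints can be zeros of `l`, and there `g` equals `ε ^ 2` or `η ^ 2`.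
    rcases hs.1.eq_or_lt with h0 | h0
    · subst h0; simp only [hgdef]; ring_nf; positivity
    rcases hs.2.eq_or_lt with h1 | h1
    · subst h1; simp only [hgdef]; ring_nf; positivity
    exact absurd h (hinterior s h0 h1).ne'
  obtain ⟨τ, hτ, hlτ, R, hR, hgR, hRle⟩ := exists_min_ratio (g := g) (by fun_prop) hlc hg hl0 hgl
    (s := 1 / 2) ⟨by norm_num, by norm_num⟩ (hinterior _ (by norm_num) (by norm_num))
  -- the two quadratic forms: slack at `τ`, and derivative in `τ`
  set γ : ℝ := η ^ 2 - ε ^ 2 - L ^ 2 + 2 * L ^ 2 * τ with hγ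
  set F : H → ℝ := fun x => g τ * ‖(LinearMap.id : H →ₗ[ℝ] H) x‖ ^ 2
    - R * ((1 - τ) * ‖P x‖ ^ 2 + τ * ‖T x‖ ^ 2) with hFdef
  set D : H → ℝ := fun x => γ * ‖(LinearMap.id : H →ₗ[ℝ] H) x‖ ^ 2
    - R * (‖T x‖ ^ 2 - ‖P x‖ ^ 2) with hDdef
  have hFc : Continuous F := by simp only [hFdef, LinearMap.id_apply]; fun_prop
  have hDc : Continuous D := by simp only [hDdef, LinearMap.id_apply]; fun_prop
  have hFhom : ∀ (s : ℝ) x, F (s • x) = s ^ 2 * F x := fun s x => by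
    simp only [hFdef, norm_map_smul_sq]; ring
  have hDhom : ∀ (s : ℝ) x, D (s • x) = s ^ 2 * D x := fun s x => by
    simp only [hDdef, norm_map_smul_sq]; ring
  have hFpar : ∀ x y, F (x + y) + F (x - y) = 2 * F x + 2 * F y := fun x y => by
    have h1 := norm_map_sq_parallelogram P x y
    have h2 := norm_map_sq_parallelogram T x y
    have h3 := norm_map_sq_parallelogram (LinearMap.id : H →ₗ[ℝ] H) x y
    simp only [hFdef]
    linear_combination g τ * h3 - R * (1 - τ) * h1 - R * τ * h2
  have hbound : ∀ x ∈ N, l τ * ‖x‖ ^ 2 ≤ (1 - τ) * ‖P x‖ ^ 2 + τ * ‖T x‖ ^ 2 := by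
    intro x hx
    by_cases hx0 : x = 0
    · simp [hx0]
    have hn : 0 < ‖x‖ := norm_pos_iff.2 hx0
    have h1 := hlle τ (‖x‖⁻¹ • x) ⟨by simp [norm_smul, inv_mul_cancel₀ hn.ne'], N.smul_mem _ hx⟩
    simp only [hGdef, norm_map_smul_sq] at h1
    have h2 := mul_le_mul_of_nonneg_right h1 (sq_nonneg ‖x‖)
    have h3 : (‖x‖⁻¹) ^ 2 * ‖x‖ ^ 2 = 1 := by
      rw [← mul_pow, inv_mul_cancel₀ hn.ne', one_pow]
    calc l τ * ‖x‖ ^ 2 ≤ _ := h2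
      _ = _ := by linear_combination ((1 - τ) * ‖P x‖ ^ 2 + τ * ‖T x‖ ^ 2) * h3
  have hFN : ∀ x ∈ N, F x ≤ 0 := fun x hx => by
    have := mul_le_mul_of_nonneg_left (hbound x hx) hR
    simp only [hFdef, LinearMap.id_apply, hgR]
    linarith
  -- The expansion of `g s - R * G s x` at `τ` is exact: `G` is affine in `s` and `g` has leading
  -- coefficient `L ^ 2`.
  have hstep : ∀ s ∈ Set.Icc (0 : ℝ) 1, ∃ x ∈ S, 0 ≤ F x + (s - τ) * D x + L ^ 2 * (s - τ) ^ 2 := by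
    intro s hs
    obtain ⟨x, hx, hxl⟩ := hlmem s
    refine ⟨x, hx, ?_⟩
    have h1 := hRle s hs
    rw [← hxl] at h1
    have h2 : F x + (s - τ) * D x + L ^ 2 * (s - τ) ^ 2 = g s - R * G s x := by
      simp only [hFdef, hDdef, hgdef, hGdef, hγ, LinearMap.id_apply, hSnorm x hx]
      ring
    linarith
  have hFS : ∀ x ∈ S, F x ≤ 0 := fun x hx => hFN x hx.2
  have hright : τ < 1 → ∃ x ∈ S, F x = 0 ∧ 0 ≤ D x := fun h =>
    exists_first_order hSc hFc hDc (L ^ 2) (1 - τ) (sub_pos.2 h) hFS fun t ht0 ht1 => by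
      obtain ⟨x, hx, h2⟩ := hstep (τ + t) ⟨by linarith [hτ.1], by linarith⟩
      exact ⟨x, hx, by simpa using h2⟩
  have hleft : 0 < τ → ∃ x ∈ S, F x = 0 ∧ D x ≤ 0 := fun h => by
    obtain ⟨x, hx, h1, h2⟩ := exists_first_order hSc hFc hDc.neg (L ^ 2) τ h hFS
      fun t ht0 ht1 => by
        obtain ⟨x, hx, h2⟩ := hstep (τ - t) ⟨by linarith, by linarith [hτ.2]⟩
        refine ⟨x, hx, h2.trans_eq ?_⟩
        simp only [Pi.neg_apply]
        ring
    exact ⟨x, hx, h1, by simpa using h2⟩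
  -- The weights `1 - τ` and `τ` cover all cases: at an endpoint only one sign of `D x` is
  -- available, and the other weight is zero.
  have hslack : ∃ x ∈ N, ‖x‖ = 1 ∧ F x = 0 ∧ 0 ≤ (1 - τ) * D x ∧ τ * D x ≤ 0 := by
    rcases hτ.1.eq_or_lt with h0 | h0
    · obtain ⟨x, hx, h1, h2⟩ := hright (by linarith)
      exact ⟨x, hx.2, hSnorm x hx, h1, by simpa [← h0] using h2, by simp [← h0]⟩
    rcases hτ.2.eq_or_lt with h1 | h1
    · obtain ⟨x, hx, h3, h2⟩ := hleft h0
      exact ⟨x, hx.2, hSnorm x hx, h3, by simp [h1], by simpa [h1] using h2⟩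
    obtain ⟨x, hx, hFx, hDx⟩ := hright h1
    obtain ⟨y, hy, hFy, hDy⟩ := hleft h0
    obtain ⟨z, hz, hz1, hFz, hDz⟩ := exists_null_of_signs N hDc hFpar hFhom hDhom hFN hx.2 hy.2
      (hSnorm x hx) (hSnorm y hy) hFx hFy hDx hDy
    exact ⟨z, hz, hz1, hFz, by simp [hDz], by simp [hDz]⟩
  obtain ⟨x, hxN, hx1, hFx, hD1, hD0⟩ := hslack
  have hsq : √R ^ 2 = R := Real.sq_sqrt hR
  simp only [hFdef, hDdef, hgdef, hγ, LinearMap.id_apply, hx1] at hFx hD1 hD0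
  refine ⟨τ, hτ, l τ, hlτ, ?_, hbound, √R • x, N.smul_mem _ hxN, ?_, ?_, ?_⟩
  · have h1 := hbound x hxN
    rw [hx1] at h1
    have h2 : ‖P x‖ ^ 2 ≤ 1 := pow_le_one₀ (norm_nonneg _) (hx1 ▸ hP x)
    have h3 : ‖T x‖ ^ 2 ≤ 1 := pow_le_one₀ (norm_nonneg _) (hx1 ▸ hT x)
    nlinarith [mul_le_mul_of_nonneg_left h2 (sub_nonneg.2 hτ.2),
      mul_le_mul_of_nonneg_left h3 hτ.1]
  · rw [norm_smul, hx1, mul_one, Real.norm_eq_abs, sq_abs, hsq, mul_comm]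
    exact hgR.symm
  -- `F x - τ * D x` equals `ε ^ 2 - τ ^ 2 * L ^ 2 - R * ‖P x‖ ^ 2`; likewise `F x + (1 - τ) * D x`
  -- gives the bound for `T`.
  · rw [norm_map_smul_sq, hsq]
    linarith
  · rw [norm_map_smul_sq, hsq]
    linarith

/-! ### Projections, the normal equation and weak duality -/

section
open InnerProductSpace
open scoped RealInnerProductSpace

variable {H : Type*} [NormedAddCommGroup H] [InnerProductSpace ℝ H] {P : H →ₗ[ℝ] H}

theorem LinearMap.IsSymmetricProjection.inner_self_eq (hP : P.IsSymmetricProjection) (x : H) :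
    ⟪P x, x⟫ = ‖P x‖ ^ 2 := by
  have h1 : P (P x) = P x := LinearMap.congr_fun hP.isIdempotentElem.eq x
  rw [← real_inner_self_eq_norm_sq, hP.isSymmetric (P x) x |>.symm, h1]

theorem LinearMap.IsSymmetricProjection.norm_map_le (hP : P.IsSymmetricProjection) (x : H) :
    ‖P x‖ ≤ ‖x‖ := by
  have h1 := hP.inner_self_eq x
  have h2 := real_inner_le_norm (P x) x
  by_contra h
  push Not at h
  nlinarith [norm_nonneg x, norm_nonneg (P x)]

/-- A ball that contains the segment `[f - v, f + v]` has radius at least `‖v‖`, with equality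
only if its center is `f`. -/
theorem norm_sub_sq_add_le {f v z : H} {r : ℝ} (h1 : f + v ∈ Metric.closedBall z r)
    (h2 : f - v ∈ Metric.closedBall z r) : ‖f - z‖ ^ 2 + ‖v‖ ^ 2 ≤ r ^ 2 := by
  rw [mem_closedBall_iff_norm] at h1 h2
  have h3 := parallelogram_law_with_norm ℝ (f - z) v
  rw [show f - z + v = f + v - z by abel, show f - z - v = f - v - z by abel] at h3
  have h4 := pow_le_pow_left₀ (norm_nonneg _) h1 2
  have h5 := pow_le_pow_left₀ (norm_nonneg _) h2 2
  linarith

variable [FiniteDimensional ℝ H] {m : ℕ} {Λ : H →ₗ[ℝ] EuclideanSpace ℝ (Fin m)}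
  {y : EuclideanSpace ℝ (Fin m)} {c d t ε η : ℝ}

theorem isSymmetricProjection_adjoint_comp (hΛ : Λ ∘ₗ Λ.adjoint = LinearMap.id) :
    (Λ.adjoint ∘ₗ Λ).IsSymmetricProjection where
  isIdempotentElem := by
    ext x
    exact congrArg Λ.adjoint (LinearMap.congr_fun hΛ (Λ x))
  isSymmetric x z := by
    simp [LinearMap.adjoint_inner_left, LinearMap.adjoint_inner_right]

theorem norm_adjoint_apply (hΛ : Λ ∘ₗ Λ.adjoint = LinearMap.id) (e : EuclideanSpace ℝ (Fin m)) :
    ‖Λ.adjoint e‖ = ‖e‖ := by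
  have h1 : Λ (Λ.adjoint e) = e := LinearMap.congr_fun hΛ e
  have h2 : ‖Λ.adjoint e‖ ^ 2 = ‖e‖ ^ 2 := by
    rw [← real_inner_self_eq_norm_sq, LinearMap.adjoint_inner_left, h1, real_inner_self_eq_norm_sq]
  exact (pow_left_inj₀ (norm_nonneg _) (norm_nonneg _) two_ne_zero).1 h2

theorem isSymmetric_combination (hP : P.IsSymmetricProjection) :
    (combination P Λ c d).IsSymmetric := by
  intro x z
  simp [combination, inner_add_left, inner_add_right, real_inner_smul_left, real_inner_smul_right,
    LinearMap.adjoint_inner_left, LinearMap.adjoint_inner_right, hP.isSymmetric x z]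

theorem inner_combination_self (hP : P.IsSymmetricProjection) (x : H) :
    ⟪combination P Λ c d x, x⟫ = c * ‖P x‖ ^ 2 + d * ‖Λ x‖ ^ 2 := by
  simp [combination, inner_add_left, real_inner_smul_left,
    LinearMap.adjoint_inner_left, hP.inner_self_eq]

theorem inner_combination_le_iff (hP : P.IsSymmetricProjection) :
    (combination P Λ c d - LinearMap.id).IsPositive ↔
      ∀ x, ‖x‖ ^ 2 ≤ c * ‖P x‖ ^ 2 + d * ‖Λ x‖ ^ 2 := by
  constructor
  · intro h x
    have h1 := h.re_inner_nonneg_left x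
    rw [LinearMap.sub_apply, inner_sub_left, inner_combination_self hP] at h1
    simpa using h1
  · intro h
    refine ⟨(isSymmetric_combination hP).sub LinearMap.IsSymmetric.id, fun x => ?_⟩
    rw [LinearMap.sub_apply, inner_sub_left, inner_combination_self hP]
    simpa using h x

/-- Expansion of the regularization functional around a solution of the normal equation. -/
theorem functional_expand (hP : P.IsSymmetricProjection) {f : H}
    (hf : combination P Λ c d f = d • Λ.adjoint y) (x : H) :
    c * ‖P x‖ ^ 2 + d * ‖y - Λ x‖ ^ 2 =
      d * ‖y‖ ^ 2 - ⟪combination P Λ c d f, f⟫ + (c * ‖P (x - f)‖ ^ 2 + d * ‖Λ (x - f)‖ ^ 2) := by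
  have h1 : ⟪combination P Λ c d f, x⟫ = d * ⟪y, Λ x⟫ := by
    rw [hf, real_inner_smul_left, LinearMap.adjoint_inner_left]
  have h2 := norm_sub_sq_real y (Λ x)
  have h3 := inner_combination_self (Λ := Λ) (c := c) (d := d) hP x
  have h4 : ⟪combination P Λ c d x, f⟫ = ⟪combination P Λ c d f, x⟫ :=
    (isSymmetric_combination hP x f).trans (real_inner_comm _ _)
  rw [← inner_combination_self hP, map_sub, inner_sub_left, inner_sub_right, inner_sub_right, h3,
    h2, h4, h1]
  ring

theorem inner_blockOperator_self (x : WithLp 2 (H × ℝ)) :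
    ⟪blockOperator (combination P Λ c d) (d • Λ.adjoint y)
      (d • (innerₗ (EuclideanSpace ℝ (Fin m)) y ∘ₗ Λ)) t x, x⟫ =
      ⟪combination P Λ c d x.fst, x.fst⟫ + 2 * x.snd * ⟪d • Λ.adjoint y, x.fst⟫
        + t * x.snd ^ 2 := by
  rw [WithLp.prod_inner_apply]
  simp [blockOperator, inner_add_left, real_inner_smul_left, LinearMap.adjoint_inner_left]
  ring

theorem isSymmetric_blockOperator (hP : P.IsSymmetricProjection) :
    (blockOperator (combination P Λ c d) (d • Λ.adjoint y)
      (d • (innerₗ (EuclideanSpace ℝ (Fin m)) y ∘ₗ Λ)) t).IsSymmetric := by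
  intro x z
  have h := isSymmetric_combination (Λ := Λ) (c := c) (d := d) hP x.fst z.fst
  rw [WithLp.prod_inner_apply, WithLp.prod_inner_apply]
  simp [blockOperator, inner_add_left, inner_add_right, real_inner_smul_left,
    real_inner_smul_right, LinearMap.adjoint_inner_left, LinearMap.adjoint_inner_right, h,
    real_inner_comm y]
  ring

/-- A Schur complement: minimizing the block form over its first component gives `t - ⟪A f, f⟫`
times the square of the second, with `A = c P + d Λ* Λ`. No inverse of `A` is needed once `f` solves
the normal equation. -/
theorem mem_sdpFeasible_iff (hP : P.IsSymmetricProjection) {f : H}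
    (hf : combination P Λ c d f = d • Λ.adjoint y) :
    (c, d, t) ∈ sdpFeasible P Λ y ↔ 0 ≤ c ∧ 0 ≤ d ∧
      (∀ x, ‖x‖ ^ 2 ≤ c * ‖P x‖ ^ 2 + d * ‖Λ x‖ ^ 2) ∧ ⟪combination P Λ c d f, f⟫ ≤ t := by
  change (0 ≤ c ∧ 0 ≤ d ∧ _ ∧ _) ↔ _
  rw [inner_combination_le_iff hP]
  refine and_congr_right fun _ => and_congr_right fun _ => and_congr_right fun hA => ?_
  constructor
  · intro h
    have h1 := h.re_inner_nonneg_left (WithLp.toLp 2 (-f, 1))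
    rw [inner_blockOperator_self, ← hf] at h1
    simp at h1
    linarith
  · intro h
    refine ⟨isSymmetric_blockOperator hP, fun x => ?_⟩
    rw [inner_blockOperator_self, ← hf]
    have h1 := inner_combination_self (Λ := Λ) (c := c) (d := d) hP (x.fst + x.snd • f)
    have h2 := (sq_nonneg _).trans (hA (x.fst + x.snd • f))
    have h4 : ⟪combination P Λ c d x.fst, f⟫ = ⟪combination P Λ c d f, x.fst⟫ :=
      (isSymmetric_combination hP x.fst f).trans (real_inner_comm _ _)
    rw [← h1, map_add, map_smul, inner_add_left, inner_add_right, inner_add_right,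
      real_inner_smul_left, real_inner_smul_left, real_inner_smul_right, real_inner_smul_right,
      h4] at h2
    have h3 := mul_le_mul_of_nonneg_right h (sq_nonneg x.snd)
    rw [RCLike.re_to_real]
    nlinarith

theorem exists_normal_equation (hP : P.IsSymmetricProjection)
    (hA : ∀ x, ‖x‖ ^ 2 ≤ c * ‖P x‖ ^ 2 + d * ‖Λ x‖ ^ 2) (z : H) :
    ∃ f, combination P Λ c d f = z := by
  have hinj : Function.Injective (combination P Λ c d) := by
    rw [← LinearMap.ker_eq_bot, LinearMap.ker_eq_bot']
    intro x hx
    have h1 := inner_combination_self (Λ := Λ) (c := c) (d := d) hP x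
    rw [hx, inner_zero_left] at h1
    have h2 := hA x
    rw [← h1] at h2
    simpa using le_antisymm h2 (sq_nonneg _)
  exact LinearMap.injective_iff_surjective.1 hinj z

theorem regularizers_eq_singleton (hP : P.IsSymmetricProjection)
    (hA : ∀ x, ‖x‖ ^ 2 ≤ c * ‖P x‖ ^ 2 + d * ‖Λ x‖ ^ 2) {f : H}
    (hf : combination P Λ c d f = d • Λ.adjoint y) : regularizers P Λ y c d = {f} := by
  ext g
  simp only [regularizers, Set.mem_ofPred_eq, Set.mem_singleton_iff, isMinOn_iff, Set.mem_univ,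
    forall_true_left, functional_expand hP hf]
  constructor
  · intro h
    have h1 := h f
    have h2 := hA (g - f)
    simp only [sub_self, map_zero, norm_zero] at h1
    have h3 : ‖g - f‖ ^ 2 = 0 := le_antisymm (by linarith) (sq_nonneg _)
    simpa [sub_eq_zero] using h3
  · rintro rfl x
    have := (sq_nonneg _).trans (hA (x - g))
    simp only [sub_self, map_zero, norm_zero]
    linarith

/-- Weak duality: a feasible triple yields a ball that contains the consistent set. -/
theorem norm_sub_sq_le_objective (hP : P.IsSymmetricProjection) {f : H}
    (hf : combination P Λ c d f = d • Λ.adjoint y) (hfeas : (c, d, t) ∈ sdpFeasible P Λ y) {x : H}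
    (hx : x ∈ consistentSet Λ (modelSet P ε) (uncertaintySet m η) y) :
    ‖x - f‖ ^ 2 ≤ sdpObjective ε η y (c, d, t) := by
  obtain ⟨hc, hd, hA, ht⟩ := (mem_sdpFeasible_iff hP hf).1 hfeas
  have h1 := functional_expand hP hf x
  have h2 := hA (x - f)
  have h3 : ‖P x‖ ^ 2 ≤ ε ^ 2 := pow_le_pow_left₀ (norm_nonneg _) hx.1 2
  have h4 : ‖y - Λ x‖ ^ 2 ≤ η ^ 2 := pow_le_pow_left₀ (norm_nonneg _) hx.2 2
  have h5 := mul_le_mul_of_nonneg_left h3 hc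
  have h6 := mul_le_mul_of_nonneg_left h4 hd
  simp only [sdpObjective]
  linarith

/-! ### The optimality certificate -/

/-- The part of the data that cannot be matched within `ker P` lies in the common range of the two
projections. -/
theorem exists_data_splitting (hP : P.IsSymmetricProjection)
    (hΛ : Λ ∘ₗ Λ.adjoint = LinearMap.id) (y : EuclideanSpace ℝ (Fin m)) :
    ∃ u q : H, P u = 0 ∧ P q = q ∧ Λ.adjoint (Λ q) = q ∧ Λ u + Λ q = y := by
  have hQ := isSymmetricProjection_adjoint_comp hΛ
  set W := (LinearMap.ker P).map (Λ.adjoint ∘ₗ Λ) with hW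
  obtain ⟨w, hw, q, hq, hwq⟩ := W.exists_add_mem_mem_orthogonal (Λ.adjoint y)
  obtain ⟨u, hu, rfl⟩ := hw
  have hΛΛ : ∀ e, Λ (Λ.adjoint e) = e := fun e => LinearMap.congr_fun hΛ e
  have hΛq : Λ u + Λ q = y := by
    have := congrArg Λ hwq
    simpa [hΛΛ] using this.symm
  have hQq : Λ.adjoint (Λ q) = q := by
    have h1 : q = Λ.adjoint (y - Λ u) := by
      rw [map_sub, hwq]; simp
    rw [h1, hΛΛ]
  have hPP : ∀ x, P (P x) = P x := fun x => LinearMap.congr_fun hP.isIdempotentElem.eq x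
  have hPq : P q = q := by
    -- `q` is orthogonal to the image of `ker P` under `Λ* Λ` and is fixed by this self-adjoint map,
    -- so it is orthogonal to `ker P` itself.
    have h1 : ⟪q - P q, q⟫ = 0 := by
      have h2 := (W.mem_orthogonal q).1 hq _
        (Submodule.mem_map_of_mem (show q - P q ∈ LinearMap.ker P by simp [hPP]))
      rw [hQ.isSymmetric] at h2
      simpa [hQq] using h2
    have h3 : ⟪q - P q, P q⟫ = 0 := by
      rw [← hP.isSymmetric, map_sub, hPP, sub_self, inner_zero_left]
    have h4 : ⟪q - P q, q - P q⟫ = 0 := by rw [inner_sub_right, h1, h3, sub_zero]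
    exact (sub_eq_zero.1 (inner_self_eq_zero.1 h4)).symm
  exact ⟨u, q, hu, hPq, hQq, hΛq⟩

/-- A feasible pair `(c, d)` together with a segment in the consistent set that certifies its
optimality. -/
theorem exists_certificate (hP : P.IsSymmetricProjection)
    (hΛ : Λ ∘ₗ Λ.adjoint = LinearMap.id) (hker : LinearMap.ker P ⊓ LinearMap.ker Λ = ⊥)
    (hline : ¬ (Module.finrank ℝ H = 1 ∧ P = LinearMap.id ∧ m = 1)) (hε : 0 < ε) (hη : 0 < η)
    (hne : (consistentSet Λ (modelSet P ε) (uncertaintySet m η) y).Nonempty) :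
    ∃ (c d : ℝ) (f v : H), 0 ≤ c ∧ 0 ≤ d ∧
      (∀ x, ‖x‖ ^ 2 ≤ c * ‖P x‖ ^ 2 + d * ‖Λ x‖ ^ 2) ∧
      combination P Λ c d f = d • Λ.adjoint y ∧
      ‖v‖ ^ 2 = sdpObjective ε η y (c, d, ⟪combination P Λ c d f, f⟫) ∧
      f + v ∈ consistentSet Λ (modelSet P ε) (uncertaintySet m η) y ∧
      f - v ∈ consistentSet Λ (modelSet P ε) (uncertaintySet m η) y := by
  obtain ⟨x₀, hx₀⟩ := hne
  rcases subsingleton_or_nontrivial H with hH | hH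
  · refine ⟨0, 0, 0, 0, le_rfl, le_rfl, fun x => ?_, ?_, ?_, ?_, ?_⟩
    · simp [Subsingleton.elim x 0]
    · exact Subsingleton.elim _ _
    · simp [sdpObjective]
    · rwa [Subsingleton.elim (0 + 0 : H) x₀]
    · rwa [Subsingleton.elim (0 - 0 : H) x₀]
  obtain ⟨u, q, hu, hPq, hQq, hy⟩ := exists_data_splitting hP hΛ y
  have hQ := isSymmetricProjection_adjoint_comp hΛ
  have hΛnorm : ∀ x, ‖Λ x‖ ≤ ‖x‖ := fun x =>
    (norm_adjoint_apply hΛ (Λ x)).symm.trans_le (hQ.norm_map_le x)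
  have hΛq : ‖Λ q‖ = ‖q‖ := by rw [← norm_adjoint_apply hΛ, hQq]
  have hΛinner : ∀ x, ⟪Λ q, Λ x⟫ = ⟪q, x⟫ := fun x => by
    rw [← LinearMap.adjoint_inner_left, hQq]
  have hPinner : ∀ x, ⟪q, P x⟫ = ⟪q, x⟫ := fun x => by rw [← hP.isSymmetric, hPq]
  -- Test a consistent point against `q`: `⟪q, P x₀⟫ + ⟪Λ q, y - Λ x₀⟫ = ‖q‖ ^ 2`.
  have hql : ‖q‖ ≤ ε + η := by
    have h1 : ⟪q, P x₀⟫ ≤ ‖q‖ * ε :=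
      (real_inner_le_norm _ _).trans (mul_le_mul_of_nonneg_left hx₀.1 (norm_nonneg _))
    have h2 : ⟪Λ q, y - Λ x₀⟫ ≤ ‖q‖ * η :=
      (real_inner_le_norm _ _).trans
        (hΛq ▸ mul_le_mul_of_nonneg_left hx₀.2 (norm_nonneg _))
    have h3 : ⟪q, u⟫ = 0 := by rw [← hPinner, hu, inner_zero_right]
    rw [← hy, inner_sub_right, inner_add_right, hΛinner, hΛinner, hΛinner, h3] at h2
    rw [hPinner] at h1
    rw [real_inner_self_eq_norm_sq] at h2
    rcases (norm_nonneg q).eq_or_lt with h | h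
    · rw [← h]; positivity
    · refine le_of_mul_le_mul_left ?_ h
      nlinarith
  have hg : ∀ s ∈ Set.Icc (0 : ℝ) 1,
      0 ≤ (1 - s) * ε ^ 2 + s * η ^ 2 - s * (1 - s) * ‖q‖ ^ 2 := by
    intro s hs
    have h1 : ‖q‖ ^ 2 ≤ (ε + η) ^ 2 := pow_le_pow_left₀ (norm_nonneg _) hql 2
    have h2 := mul_le_mul_of_nonneg_left h1 (mul_nonneg hs.1 (sub_nonneg.2 hs.2))
    -- `(1 - s) ε² + s η² = s (1 - s) (ε + η)² + ((1 - s) ε - s η)²`.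
    nlinarith [sq_nonneg ((1 - s) * ε - s * η)]
  -- If `q` spans `H`, then `P` is the identity and `Λ` is bijective: exactly the excluded case.
  have hN : (ℝ ∙ q)ᗮ ≠ ⊥ := by
    intro h
    rw [Submodule.orthogonal_eq_bot_iff] at h
    have hmem : ∀ x : H, ∃ a : ℝ, a • q = x := fun x =>
      Submodule.mem_span_singleton.1 (h ▸ Submodule.mem_top)
    have hq0 : q ≠ 0 := by
      rintro rfl
      obtain ⟨x, hx⟩ := exists_ne (0 : H)
      obtain ⟨a, ha⟩ := hmem x
      exact hx (by simpa using ha.symm)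
    have hdim : Module.finrank ℝ H = 1 := by
      rw [← finrank_top, ← h, finrank_span_singleton hq0]
    refine hline ⟨hdim, ?_, ?_⟩
    · ext x
      obtain ⟨a, rfl⟩ := hmem x
      simp [hPq]
    · have hsurj : Function.Surjective Λ := fun e => ⟨_, LinearMap.congr_fun hΛ e⟩
      have hinj : Function.Injective Λ := by
        rw [← LinearMap.ker_eq_bot, LinearMap.ker_eq_bot']
        intro x hx
        obtain ⟨a, rfl⟩ := hmem x
        rw [← hQq, ← map_smul, ← map_smul, hx, map_zero]
      have := (LinearEquiv.ofBijective Λ ⟨hinj, hsurj⟩).finrank_eq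
      rw [hdim] at this
      simpa using this.symm
  obtain ⟨τ, hτ, l, hl0, hl1, hbound, v, hv, hvn, hPv, hΛv⟩ :=
    exists_multipliers P Λ (ℝ ∙ q)ᗮ hN hP.norm_map_le hΛnorm
      (fun x _ h1 h2 => by
        have : x ∈ LinearMap.ker P ⊓ LinearMap.ker Λ := ⟨h1, h2⟩
        simpa [hker] using this) hε hη hg
  have hlc : l * ((1 - τ) / l) = 1 - τ := mul_div_cancel₀ _ hl0.ne'
  have hld : l * (τ / l) = τ := mul_div_cancel₀ _ hl0.ne'
  have hc0 : 0 ≤ (1 - τ) / l := div_nonneg (sub_nonneg.2 hτ.2) hl0.le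
  have hd0 : 0 ≤ τ / l := div_nonneg hτ.1 hl0.le
  generalize (1 - τ) / l = c at hlc hc0
  generalize τ / l = d at hld hd0
  -- This is `A ⪰ Id` in the direction of `q`, where both forms equal the squared norm; it holds
  -- because `l ≤ 1`.
  have hcd : 1 ≤ c + d := by
    have : l * (c + d) = 1 := by linarith
    by_contra h
    push Not at h
    nlinarith
  have hPadd : ∀ (a : ℝ) x, x ∈ (ℝ ∙ q)ᗮ → ‖P (a • q + x)‖ ^ 2 = a ^ 2 * ‖q‖ ^ 2 + ‖P x‖ ^ 2 := by
    intro a x hx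
    rw [Submodule.mem_orthogonal_singleton_iff_inner_right] at hx
    rw [map_add, map_smul, hPq, norm_add_sq_real, real_inner_smul_left, hPinner, hx, norm_smul,
      mul_pow, Real.norm_eq_abs, sq_abs]
    ring
  have hΛadd : ∀ (a : ℝ) x, x ∈ (ℝ ∙ q)ᗮ →
      ‖Λ (a • q + x)‖ ^ 2 = a ^ 2 * ‖q‖ ^ 2 + ‖Λ x‖ ^ 2 := by
    intro a x hx
    rw [Submodule.mem_orthogonal_singleton_iff_inner_right] at hx
    rw [map_add, map_smul, norm_add_sq_real, real_inner_smul_left, hΛinner, hx, norm_smul,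
      mul_pow, Real.norm_eq_abs, sq_abs, hΛq]
    ring
  have hmem : ∀ w ∈ (ℝ ∙ q)ᗮ, ‖P w‖ ^ 2 ≤ ε ^ 2 - τ ^ 2 * ‖q‖ ^ 2 →
      ‖Λ w‖ ^ 2 ≤ η ^ 2 - (1 - τ) ^ 2 * ‖q‖ ^ 2 →
      u + τ • q + w ∈ consistentSet Λ (modelSet P ε) (uncertaintySet m η) y := by
    intro w hw h1 h2
    refine ⟨?_, ?_⟩
    · change ‖P _‖ ≤ ε
      rw [add_assoc, map_add, hu, zero_add]
      refine le_of_sq_le_sq ?_ hε.le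
      rw [hPadd _ _ hw]
      linarith
    · change ‖y - Λ _‖ ≤ η
      have e : y - Λ (u + τ • q + w) = Λ ((1 - τ) • q + -w) := by
        rw [← hy]
        simp only [map_add, map_sub, map_smul, map_neg, sub_smul, one_smul]
        abel
      rw [e]
      refine le_of_sq_le_sq ?_ hη.le
      rw [hΛadd _ _ (Submodule.neg_mem _ hw), map_neg, norm_neg]
      linarith
  -- The weight of `q` is `τ = d / (c + d)`.
  have hf : combination P Λ c d (u + τ • q) = d • Λ.adjoint y := by
    have h1 : combination P Λ c d (u + τ • q) =
        (c * τ) • q + d • (Λ.adjoint (Λ u) + τ • q) := by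
      simp [combination, hu, hPq, hQq, smul_smul]
    have h2 : (c + d) * τ = d := by
      have h3 : l * ((c + d) * τ) = l * d := by linear_combination τ * (hlc + hld) - hld
      exact mul_left_cancel₀ hl0.ne' h3
    rw [h1, ← hy, map_add, hQq, smul_add, smul_add, smul_smul, ← add_assoc,
      add_comm ((c * τ) • q), add_assoc, ← add_smul, ← add_mul, h2]
  refine ⟨c, d, u + τ • q, v, hc0, hd0, fun x => ?_, hf, ?_, hmem v hv hPv hΛv, ?_⟩
  · obtain ⟨z, hz, w, hw, rfl⟩ := (ℝ ∙ q).exists_add_mem_mem_orthogonal x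
    obtain ⟨a, rfl⟩ := Submodule.mem_span_singleton.1 hz
    have h1 : ‖a • q + w‖ ^ 2 = a ^ 2 * ‖q‖ ^ 2 + ‖w‖ ^ 2 := by
      rw [norm_add_sq_real, real_inner_smul_left,
        Submodule.mem_orthogonal_singleton_iff_inner_right.1 hw, norm_smul, mul_pow,
        Real.norm_eq_abs, sq_abs]
      ring
    have h2 : ‖w‖ ^ 2 ≤ c * ‖P w‖ ^ 2 + d * ‖Λ w‖ ^ 2 := by
      refine le_of_mul_le_mul_left ?_ hl0
      calc l * ‖w‖ ^ 2 ≤ _ := hbound w hw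
        _ = _ := by linear_combination -‖P w‖ ^ 2 * hlc - ‖Λ w‖ ^ 2 * hld
    have h3 := mul_le_mul_of_nonneg_right hcd (mul_nonneg (sq_nonneg a) (sq_nonneg ‖q‖))
    rw [h1, hPadd _ _ hw, hΛadd _ _ hw]
    linarith
  · have h1 := functional_expand hP hf (u + τ • q)
    have h2 : P (u + τ • q) = τ • q := by simp [hu, hPq]
    have h3 : y - Λ (u + τ • q) = (1 - τ) • Λ q := by
      rw [← hy]
      simp only [map_add, map_smul, sub_smul, one_smul]
      abel
    rw [h2, h3, sub_self, map_zero, map_zero, norm_zero, norm_zero, norm_smul, norm_smul, mul_pow,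
      mul_pow, Real.norm_eq_abs, Real.norm_eq_abs, sq_abs, sq_abs, hΛq] at h1
    refine mul_left_cancel₀ hl0.ne' ?_
    simp only [sdpObjective]
    linear_combination hvn - l * h1 - (ε ^ 2 - τ ^ 2 * ‖q‖ ^ 2) * hlc
      - (η ^ 2 - (1 - τ) ^ 2 * ‖q‖ ^ 2) * hld
  · rw [sub_eq_add_neg]
    exact hmem (-v) (Submodule.neg_mem _ hv) (by rwa [map_neg, norm_neg])
      (by rwa [map_neg, norm_neg])

end

/-! ### Radius, optimal value and center -/

theorem theorem1 {H : Type*} [NormedAddCommGroup H] [InnerProductSpace ℝ H]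
    [FiniteDimensional ℝ H] {m : ℕ}
    (P : H →ₗ[ℝ] H) (hP : P.IsSymmetricProjection)
    (Λ : H →ₗ[ℝ] EuclideanSpace ℝ (Fin m)) (hΛ : Λ ∘ₗ Λ.adjoint = LinearMap.id)
    (hker : LinearMap.ker P ⊓ LinearMap.ker Λ = ⊥)
    (hline : ¬ (Module.finrank ℝ H = 1 ∧ P = LinearMap.id ∧ m = 1))
    (ε η : ℝ) (hε : 0 < ε) (hη : 0 < η) (y : EuclideanSpace ℝ (Fin m))
    (hne : (consistentSet Λ (modelSet P ε) (uncertaintySet m η) y).Nonempty) :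
    (∃ r : ℝ, IsChebyshevRadius (consistentSet Λ (modelSet P ε) (uncertaintySet m η) y) r ∧
      IsLeast (sdpObjective ε η y '' sdpFeasible P Λ y) (r ^ 2)) ∧
    ∀ c d t : ℝ, IsSDPSolution P Λ ε η y (c, d, t) →
      ∃ f : H, regularizers P Λ y c d = {f} ∧
        {z : H | IsChebyshevCenter
          (consistentSet Λ (modelSet P ε) (uncertaintySet m η) y) z} = {f} := by
  obtain ⟨c₀, d₀, f₀, v, hc₀, hd₀, hA₀, hf₀, hv, hadd, hsub⟩ :=
    exists_certificate hP hΛ hker hline hε hη hne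
  set S := consistentSet Λ (modelSet P ε) (uncertaintySet m η) y with hS
  have hfeas₀ := (mem_sdpFeasible_iff (t := inner ℝ (combination P Λ c₀ d₀ f₀) f₀) hP hf₀).2
    ⟨hc₀, hd₀, hA₀, le_rfl⟩
  have hball : ∀ c d t, (c, d, t) ∈ sdpFeasible P Λ y →
      ∃ f, combination P Λ c d f = d • Λ.adjoint y ∧ regularizers P Λ y c d = {f} ∧
        S ⊆ Metric.closedBall f √(sdpObjective ε η y (c, d, t)) := by
    intro c d t h
    have hA := (inner_combination_le_iff hP).1 h.2.2.1
    obtain ⟨f, hf⟩ := exists_normal_equation hP hA (d • Λ.adjoint y)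
    refine ⟨f, hf, regularizers_eq_singleton hP hA hf, fun x hx => ?_⟩
    rw [mem_closedBall_iff_norm]
    exact Real.le_sqrt_of_sq_le (norm_sub_sq_le_objective hP hf h hx)
  have hlow : ∀ r ∈ coveringRadii S, ‖v‖ ≤ r := by
    rintro r ⟨hr, z, hz⟩
    have := norm_sub_sq_add_le (hz hadd) (hz hsub)
    exact le_of_sq_le_sq (by linarith [sq_nonneg ‖f₀ - z‖]) hr
  have hsq : √(‖v‖ ^ 2) = ‖v‖ := Real.sqrt_sq (norm_nonneg _)
  have hrad : IsChebyshevRadius S ‖v‖ := by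
    refine IsLeast.isGLB ⟨⟨norm_nonneg _, ?_⟩, hlow⟩
    obtain ⟨f, -, -, h⟩ := hball _ _ _ hfeas₀
    exact ⟨f, by rwa [← hv, hsq] at h⟩
  have hleast : IsLeast (sdpObjective ε η y '' sdpFeasible P Λ y) (‖v‖ ^ 2) := by
    refine ⟨⟨_, hfeas₀, hv.symm⟩, ?_⟩
    rintro _ ⟨⟨c, d, t⟩, h, rfl⟩
    obtain ⟨f, hf, -, hfb⟩ := hball c d t h
    have h1 := hlow _ ⟨Real.sqrt_nonneg _, f, hfb⟩
    have h2 : 0 ≤ sdpObjective ε η y (c, d, t) :=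
      (sq_nonneg _).trans (norm_sub_sq_le_objective hP hf h hadd)
    exact (Real.le_sqrt (norm_nonneg _) h2).1 h1
  have huniq : ∀ z, IsChebyshevCenter S z → z = f₀ := by
    rintro z ⟨r, hr, hz⟩
    obtain rfl := hr.unique hrad
    have h1 := norm_sub_sq_add_le (hz hadd) (hz hsub)
    have h2 : ‖f₀ - z‖ ^ 2 = 0 := le_antisymm (by linarith) (sq_nonneg _)
    exact (sub_eq_zero.1 (by simpa using h2)).symm
  refine ⟨⟨_, hrad, hleast⟩, fun c d t hsol => ?_⟩
  obtain ⟨f, -, hreg, hfb⟩ := hball c d t hsol.1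
  have hval : sdpObjective ε η y (c, d, t) = ‖v‖ ^ 2 :=
    le_antisymm (hv ▸ hsol.2 hfeas₀) (hleast.2 ⟨_, hsol.1, rfl⟩)
  rw [hval, hsq] at hfb
  have hcenter : IsChebyshevCenter S f := ⟨_, hrad, hfb⟩
  refine ⟨f, hreg, ?_⟩
  ext z
  simp only [Set.mem_ofPred_eq, Set.mem_singleton_iff]
  constructor
  · exact fun hz => (huniq z hz).trans (huniq f hcenter).symm
  · rintro rfl
    exact hcenter
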